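/- Let $\mathbb{Z}_n$ be the integers modulo $n$ and $\mathbb{N}_0 = \{0, 1, 2, \dots\}$. A permutation $\pi$ of $\mathbb{Z}_n$ is said to *destroy arithmetic progressions* if there is no triple $(a,b,c)$ of elements of $\mathbb{Z}_n$, not all equal, with $c-b=b-a$ and $\pi(c)-\pi(b)=\pi(b)-\pi(a)$. For $s,t\in\mathbb{N}_0$, a permutation $\pi$ of $\mathbb{Z}_n$ is said to *destroy $(s,t)$-almost arithmetic progressions* if there is no triple $(a,b,c)$ of elements of $\mathbb{Z}_n$, not all equal, such that $a+c-2b\equiv \eta_1 \pmod n$ for some integer $\eta_1\in\{0,\pm1,\dots,\pm s\}$ and $\pi(a)+\pi(c)-2\pi(b)\equiv \eta_2 \pmod n$ for some integer $\eta_2\in\{0,\pm1,\dots,\pm t\}$. **Theorem 1.2.** (i) For every integer $n\ge n_0$, where $n_0=(9\cdot 11\cdot 16\cdot 17\cdot 19\cdot 23)^2\approx 1.4\times 10^{14}$, there exists a permutation of $\mathbb{Z}_n$ that destroys arithmetic progressions. (ii) For every $s,t\in\mathbb{N}_0$ there is an $n_0(s,t)\in\mathbb{N}_0$ such that, for all integers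 $n\ge n_0(s,t)$, there exists a permutation of $\mathbb{Z}_n$ that destroys $(s,t)$-almost arithmetic progressions. -/

import Mathlib

/-- A permutation `π` of an abelian group `G` destroys arithmetic progressions if there is no
triple `(a, b, c)`, not all equal, with both `(a, b, c)` and `(π a, π b, π c)` in arithmetic
progression. -/
def DestroysAPs {G : Type*} [AddCommGroup G] (π : Equiv.Perm G) : Prop :=
  ¬ ∃ a b c : G, ¬ (a = b ∧ b = c) ∧ c - b = b - a ∧ π c - π b = π b - π a

/-- A permutation `π` of `ℤ/nℤ` destroys `(s, t)`-almost arithmetic progressions if there is no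
triple `(a, b, c)`, not all equal, with `a + c - 2 b ≡ η₁` for some integer `η₁ ∈ [-s, s]` and
`π a + π c - 2 π b ≡ η₂` for some integer `η₂ ∈ [-t, t]`, modulo `n`. -/
def DestroysAlmostAPs {n : ℕ} (s t : ℕ) (π : Equiv.Perm (ZMod n)) : Prop :=
  ¬ ∃ a b c : ZMod n, ¬ (a = b ∧ b = c) ∧
    (∃ η₁ : ℤ, |η₁| ≤ (s : ℤ) ∧ a + c - 2 * b = (η₁ : ZMod n)) ∧
    (∃ η₂ : ℤ, |η₂| ≤ (t : ℤ) ∧ π a + π c - 2 * π b = (η₂ : ZMod n))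

/-! Cut `{0, …, n - 1}` into `M` pieces of nearly equal length and rearrange the pieces by a
permutation `σ` of `ℤ/M`. A triple with small second difference modulo `n` has piece indices whose
second difference modulo `M` lies in `{-2, …, 2}`, since rounding costs at most 2, and the same
holds for the images. If `σ` tolerates no non-constant triple of this kind (`SeparatesNear`), the
three elements share a piece. Wraparound modulo `n` is then impossible, and only rankings of integer
intervals remain to be found (`exists_perm_destroysAlmostAPs`).

Such a `σ` is a product, by the Chinese remainder theorem, of four permutations of small moduli
checked by computation. Each factor excludes some of the pairs (second difference, second difference
of images), and all exclude `(0, 0)` on non-constant triples.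

For intervals, placing evens before odds recursively settles `s = t = 0`. In general, a residue
class modulo `B > s` turns a second difference of size at most `s` into zero, so each class reduces
to the case `(0, t)`. The classes are merged one at a time by `exists_ranking_residueInterval`,
using a variant of `σ` that also tells old classes from the new one (`SeparatesColored`). Applying
this to `(0, 0)`, inverting, and applying it again gives every `(s, t)`. -/

/-! ### Small tables and a separating permutation by the Chinese remainder theorem -/

/-- Whether the self-map of `{0, …, m - 1}` listed in `l` is injective with values below `m`, and
sends no triple with `a + c - 2 b = x` to a triple with second difference `y` modulo `m`, for all
`(x, y)` in `K`, constant triples excepted. -/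
def tableAvoids (m : ℕ) (l : List ℕ) (K : List (ℤ × ℤ)) : Bool :=
  decide (∀ i < m, l.getD i 0 < m ∧ ∀ j < i, l.getD i 0 ≠ l.getD j 0) &&
  K.all fun p => (List.range m).all fun a => (List.range m).all fun b =>
    (p.1 == 0 && p.2 == 0 && a == b) ||
      ((l.getD a 0 + l.getD ((p.1 + 2 * b - a) % m).toNat 0 - 2 * l.getD b 0 - p.2 : ℤ) % m != 0)

/-- The map `f` sends no non-constant triple with second difference `x` to one with second
difference `y`, for all `(x, y)` in `K`. -/
def Avoids {A : Type*} [CommRing A] (f : A → A) (K : List (ℤ × ℤ)) : Prop :=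
  ∀ a b c : A, ∀ x y : ℤ, (x, y) ∈ K → a + c - 2 * b = x → f a + f c - 2 * f b = y →
    x = 0 ∧ y = 0 ∧ a = b ∧ b = c

theorem exists_perm_avoids {m : ℕ} [NeZero m] {l : List ℕ} {K : List (ℤ × ℤ)}
    (h : tableAvoids m l K = true) : ∃ f : Equiv.Perm (ZMod m), Avoids f K := by
  simp only [tableAvoids, Bool.and_eq_true, decide_eq_true_eq, List.all_eq_true, List.mem_range,
    Bool.or_eq_true, beq_iff_eq, bne_iff_ne] at h
  obtain ⟨hl, hK⟩ := h
  let F : ZMod m → ZMod m := fun a => (l.getD a.val 0 : ℕ)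
  have hinj : Function.Injective F := by
    intro a b hab
    have h1 := (ZMod.natCast_eq_natCast_iff' _ _ _).1 hab
    rw [Nat.mod_eq_of_lt (hl _ a.val_lt).1, Nat.mod_eq_of_lt (hl _ b.val_lt).1] at h1
    rcases lt_trichotomy a.val b.val with h2 | h2 | h2
    · exact absurd h1.symm ((hl _ b.val_lt).2 _ h2)
    · exact ZMod.val_injective m h2
    · exact absurd h1 ((hl _ a.val_lt).2 _ h2)
  refine ⟨Equiv.ofBijective F (Finite.injective_iff_bijective.1 hinj), ?_⟩
  intro a b c x y hxy h1 h2
  -- `c` is determined by `a`, `b` and `x`, so the table check runs over pairs only.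
  have hc : ((x + 2 * b.val - a.val) % m).toNat = c.val := by
    have h3 : c = ((x + 2 * b.val - a.val : ℤ) : ZMod m) := by
      push_cast
      rw [ZMod.natCast_zmod_val, ZMod.natCast_zmod_val, ← h1]
      ring
    rw [h3, ← Int.natCast_inj, ZMod.val_intCast, Int.toNat_of_nonneg]
    exact Int.emod_nonneg _ (by exact_mod_cast NeZero.ne m)
  rcases hK _ hxy _ a.val_lt _ b.val_lt with h3 | h3
  · obtain ⟨⟨hx, hy⟩, hab⟩ := h3
    have hab := ZMod.val_injective m hab
    simp only at hx hy
    refine ⟨hx, hy, hab, ?_⟩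
    subst hab
    rw [hx] at h1
    have : c - a = 0 := by
      rw [Int.cast_zero] at h1
      rw [← h1]; ring
    exact (sub_eq_zero.1 this).symm
  · refine absurd ?_ h3
    simp only [hc]
    have h4 : (((l.getD a.val 0 + l.getD c.val 0 - 2 * l.getD b.val 0 - y : ℤ)) : ZMod m) = 0 := by
      have h5 : F a + F c - 2 * F b = y := h2
      simp only [F] at h5
      push_cast
      rw [h5, sub_self]
    exact Int.emod_eq_zero_of_dvd ((ZMod.intCast_zmod_eq_zero_iff_dvd _ _).1 h4)

/-- The nonzero pairs here are those of opposite parity. The table preserves parity and 20 is even,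
so these are excluded at once, and only `(0, 0)` is a real restriction. -/
theorem exists_perm_avoids_odd : ∃ f : Equiv.Perm (ZMod 20), Avoids f
    [(0, 0), (0, 1), (0, -1), (1, 0), (-1, 0), (2, 1), (2, -1), (-2, 1), (-2, -1), (1, 2), (1, -2),
      (-1, 2), (-1, -2)] :=
  exists_perm_avoids (l := [14, 17, 8, 7, 12, 13, 4, 3, 0, 11, 10, 5, 6, 1, 18, 19, 2, 15, 16, 9])
    (by decide +kernel)

theorem exists_perm_avoids_two_zero : ∃ f : Equiv.Perm (ZMod 47), Avoids f
    [(0, 0), (2, 0), (-2, 0), (0, 2), (0, -2)] :=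
  exists_perm_avoids (l := [35, 19, 33, 9, 23, 14, 37, 28, 34, 41, 36, 39, 26, 29, 20, 43, 45, 44,
    31, 11, 25, 32, 27, 42, 21, 8, 3, 6, 13, 16, 7, 10, 24, 0, 38, 5, 12, 30, 18, 17, 4, 46, 2, 40,
    15, 22, 1]) (by decide +kernel)

theorem exists_perm_avoids_one_one : ∃ f : Equiv.Perm (ZMod 49), Avoids f
    [(0, 0), (1, 1), (-1, -1), (1, -1), (-1, 1)] :=
  exists_perm_avoids (l := [44, 42, 13, 9, 48, 3, 15, 25, 7, 11, 27, 29, 19, 35, 17, 23, 37, 21, 45,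
    43, 31, 0, 33, 2, 39, 10, 41, 47, 6, 18, 14, 24, 4, 12, 8, 32, 16, 28, 22, 38, 20, 26, 30, 46,
    1, 36, 5, 34, 40]) (by decide +kernel)

theorem exists_perm_avoids_two_two : ∃ f : Equiv.Perm (ZMod 51), Avoids f
    [(0, 0), (2, 2), (-2, -2), (2, -2), (-2, 2)] :=
  exists_perm_avoids (l := [28, 23, 15, 45, 40, 19, 2, 48, 31, 6, 14, 36, 44, 18, 10, 27, 5, 43, 9,
    1, 35, 30, 39, 13, 22, 38, 26, 47, 0, 25, 42, 17, 12, 21, 46, 34, 4, 37, 8, 20, 29, 41, 33, 50,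
    24, 11, 16, 3, 32, 49, 7]) (by decide +kernel)

theorem exists_perm_avoids_zero_one : ∃ f : Equiv.Perm (ZMod 23), Avoids f
    [(0, 0), (0, 1), (0, -1)] :=
  exists_perm_avoids (l := [19, 6, 5, 1, 2, 16, 13, 14, 21, 9, 18, 22, 11, 8, 20, 3, 15, 10, 12, 4,
    7, 17, 0]) (by decide +kernel)

theorem exists_perm_avoids_zero_two : ∃ f : Equiv.Perm (ZMod 29), Avoids f
    [(0, 0), (0, 2), (0, -2)] :=
  exists_perm_avoids (l := [22, 26, 24, 15, 20, 17, 7, 11, 3, 18, 27, 28, 12, 8, 19, 2, 6, 14, 25,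
    23, 16, 4, 10, 5, 13, 0, 9, 21, 1]) (by decide +kernel)

/-- The permutation `f` sends no non-constant triple with second difference in `{-2, …, 2}` to one
with second difference in `{-2, …, 2}`. -/
def SeparatesNear {A : Type*} [CommRing A] (f : Equiv.Perm A) : Prop :=
  ∀ a b c : A, ∀ x y : ℤ, |x| ≤ 2 → |y| ≤ 2 → a + c - 2 * b = x → f a + f c - 2 * f b = y →
    x = 0 ∧ y = 0 ∧ a = b ∧ b = c

theorem SeparatesNear.congr {A B : Type*} [CommRing A] [CommRing B] {f : Equiv.Perm B}
    (hf : SeparatesNear f) (e : A ≃+* B) :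
    SeparatesNear ((e.toEquiv.trans f).trans e.symm.toEquiv) := by
  intro a b c x y hx hy h1 h2
  have h3 := congrArg e h1
  have h4 := congrArg e h2
  simp only [map_sub, map_add, map_mul, map_ofNat, map_intCast] at h3 h4
  simp only [Equiv.trans_apply, RingEquiv.toEquiv_eq_coe, RingEquiv.coe_toEquiv,
    RingEquiv.apply_symm_apply] at h4
  obtain ⟨h5, h6, h7, h8⟩ := hf _ _ _ x y hx hy h3 h4
  exact ⟨h5, h6, e.injective h7, e.injective h8⟩

theorem mem_small_differences {x y : ℤ} (hx : |x| ≤ 2) (hy : |y| ≤ 2) :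
    (x = 0 ∧ y = 0) ∨ (x, y) ∈ [((0 : ℤ), (0 : ℤ)), (0, 1), (0, -1), (1, 0), (-1, 0), (2, 1),
      (2, -1), (-2, 1), (-2, -1), (1, 2), (1, -2), (-1, 2), (-1, -2)] ∨
    (x, y) ∈ [((0 : ℤ), (0 : ℤ)), (2, 0), (-2, 0), (0, 2), (0, -2)] ∨
    (x, y) ∈ [((0 : ℤ), (0 : ℤ)), (1, 1), (-1, -1), (1, -1), (-1, 1)] ∨
    (x, y) ∈ [((0 : ℤ), (0 : ℤ)), (2, 2), (-2, -2), (2, -2), (-2, 2)] := by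
  obtain ⟨hx1, hx2⟩ := abs_le.1 hx
  obtain ⟨hy1, hy2⟩ := abs_le.1 hy
  clear hx hy
  interval_cases x <;> interval_cases y <;> decide

/-- One factor excluding a nonzero pair `(x, y)` suffices to exclude it for the product. For `(0,
0)` every factor has to force its own coordinate to be constant, which is why that pair is in all
four lists. -/
theorem separatesNear_prodCongr {A B C D : Type*} [CommRing A] [CommRing B] [CommRing C]
    [CommRing D] {f₁ : Equiv.Perm A} {f₂ : Equiv.Perm B} {f₃ : Equiv.Perm C} {f₄ : Equiv.Perm D}
    (h₁ : Avoids f₁ [(0, 0), (0, 1), (0, -1), (1, 0), (-1, 0), (2, 1), (2, -1), (-2, 1), (-2, -1),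
      (1, 2), (1, -2), (-1, 2), (-1, -2)])
    (h₂ : Avoids f₂ [(0, 0), (2, 0), (-2, 0), (0, 2), (0, -2)])
    (h₃ : Avoids f₃ [(0, 0), (1, 1), (-1, -1), (1, -1), (-1, 1)])
    (h₄ : Avoids f₄ [(0, 0), (2, 2), (-2, -2), (2, -2), (-2, 2)]) :
    SeparatesNear (((f₁.prodCongr f₂).prodCongr f₃).prodCongr f₄) := by
  rintro ⟨⟨⟨a₁, a₂⟩, a₃⟩, a₄⟩ ⟨⟨⟨b₁, b₂⟩, b₃⟩, b₄⟩ ⟨⟨⟨c₁, c₂⟩, c₃⟩, c₄⟩ x y hx hy h h'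
  simp only [Prod.ext_iff, Prod.fst_sub, Prod.fst_add, Prod.fst_mul, Prod.fst_ofNat,
    Prod.snd_sub, Prod.snd_add, Prod.snd_mul, Prod.snd_ofNat, Prod.fst_intCast, Prod.snd_intCast,
    Equiv.prodCongr_apply, Prod.map_fst, Prod.map_snd] at h h'
  obtain ⟨⟨⟨g1, g2⟩, g3⟩, g4⟩ := h
  obtain ⟨⟨⟨g1', g2'⟩, g3'⟩, g4'⟩ := h'
  have hxy : x = 0 ∧ y = 0 := by
    rcases mem_small_differences hx hy with hK | hK | hK | hK | hK
    · exact hK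
    · have := h₁ _ _ _ x y hK g1 g1'; exact ⟨this.1, this.2.1⟩
    · have := h₂ _ _ _ x y hK g2 g2'; exact ⟨this.1, this.2.1⟩
    · have := h₃ _ _ _ x y hK g3 g3'; exact ⟨this.1, this.2.1⟩
    · have := h₄ _ _ _ x y hK g4 g4'; exact ⟨this.1, this.2.1⟩
  obtain ⟨rfl, rfl⟩ := hxy
  obtain ⟨-, -, rfl, rfl⟩ := h₁ _ _ _ 0 0 List.mem_cons_self g1 g1'
  obtain ⟨-, -, rfl, rfl⟩ := h₂ _ _ _ 0 0 List.mem_cons_self g2 g2'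
  obtain ⟨-, -, rfl, rfl⟩ := h₃ _ _ _ 0 0 List.mem_cons_self g3 g3'
  obtain ⟨-, -, rfl, rfl⟩ := h₄ _ _ _ 0 0 List.mem_cons_self g4 g4'
  exact ⟨rfl, rfl, rfl, rfl⟩

theorem exists_separatesNear : ∃ f : Equiv.Perm (ZMod (20 * 47 * 49 * 51)), SeparatesNear f := by
  obtain ⟨f₁, h₁⟩ := exists_perm_avoids_odd
  obtain ⟨f₂, h₂⟩ := exists_perm_avoids_two_zero
  obtain ⟨f₃, h₃⟩ := exists_perm_avoids_one_one
  obtain ⟨f₄, h₄⟩ := exists_perm_avoids_two_two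
  exact ⟨_, (separatesNear_prodCongr h₁ h₂ h₃ h₄).congr
    ((ZMod.chineseRemainder (m := 20 * 47 * 49) (n := 51) (by norm_num)).trans
      (((ZMod.chineseRemainder (m := 20 * 47) (n := 49) (by norm_num)).trans
        ((ZMod.chineseRemainder (m := 20) (n := 47) (by norm_num)).prodCongr
          (RingEquiv.refl _))).prodCongr (RingEquiv.refl _)))⟩

/-! ### Separation with two colors -/

/-- The permutations `a ↦ σ a` and `a ↦ σ a + h` together send no triple that is nearly an
arithmetic progression to one, even if different permutations are used for its members. -/
def SeparatesColored {A : Type*} [CommRing A] (σ : Equiv.Perm A) (h : A) : Prop :=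
  ∀ a b c : A, ∀ i j k x y : ℤ, (i = 0 ∨ i = 1) → (j = 0 ∨ j = 1) → (k = 0 ∨ k = 1) →
    |x| ≤ 2 → |y| ≤ 2 → a + c - 2 * b = x →
    (σ a + h * i) + (σ c + h * k) - 2 * (σ b + h * j) = y → a = b ∧ b = c ∧ i = j ∧ j = k

theorem SeparatesColored.congr {A B : Type*} [CommRing A] [CommRing B] {f : Equiv.Perm B} {h : B}
    (hf : SeparatesColored f h) (e : A ≃+* B) :
    SeparatesColored ((e.toEquiv.trans f).trans e.symm.toEquiv) (e.symm h) := by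
  intro a b c i j k x y hi hj hk hx hy h1 h2
  have h3 := congrArg e h1
  have h4 := congrArg e h2
  simp only [map_sub, map_add, map_mul, map_ofNat, map_intCast] at h3 h4
  simp only [Equiv.trans_apply, RingEquiv.toEquiv_eq_coe, RingEquiv.coe_toEquiv,
    RingEquiv.apply_symm_apply] at h4
  obtain ⟨h5, h6, h7⟩ := hf _ _ _ i j k x y hi hj hk hx hy h3 h4
  exact ⟨e.injective h5, e.injective h6, h7⟩

/-- The shift vanishes in the first factor, which therefore forces `x = y = 0`. In the other two it
is 1, so unequal colors show up there as the second difference `2j - i - k`, which is `±1` or `±2`;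
each factor excludes one of the two sizes. -/
theorem separatesColored_prodCongr {A B C : Type*} [CommRing A] [CommRing B] [CommRing C]
    {f₁ : Equiv.Perm A} {f₂ : Equiv.Perm B} {f₃ : Equiv.Perm C} (h₁ : SeparatesNear f₁)
    (h₂ : Avoids f₂ [(0, 0), (0, 1), (0, -1)]) (h₃ : Avoids f₃ [(0, 0), (0, 2), (0, -2)]) :
    SeparatesColored ((f₁.prodCongr f₂).prodCongr f₃) ((0, 1), 1) := by
  rintro ⟨⟨a₁, a₂⟩, a₃⟩ ⟨⟨b₁, b₂⟩, b₃⟩ ⟨⟨c₁, c₂⟩, c₃⟩ i j k x y hi hj hk hx hy h h'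
  simp only [Prod.ext_iff, Prod.fst_sub, Prod.fst_add, Prod.fst_mul, Prod.fst_ofNat,
    Prod.snd_sub, Prod.snd_add, Prod.snd_mul, Prod.snd_ofNat, Prod.fst_intCast, Prod.snd_intCast,
    Equiv.prodCongr_apply, Prod.map_fst, Prod.map_snd, zero_mul, add_zero, one_mul] at h h'
  obtain ⟨⟨g1, g2⟩, g3⟩ := h
  obtain ⟨⟨g1', g2'⟩, g3'⟩ := h'
  obtain ⟨rfl, rfl, rfl, rfl⟩ := h₁ _ _ _ x y hx hy g1 g1'
  have k2 := fun hK => h₂ _ _ _ 0 (2 * j - i - k) hK g2 (by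
    push_cast at g2' ⊢; linear_combination g2')
  have k3 := fun hK => h₃ _ _ _ 0 (2 * j - i - k) hK g3 (by
    push_cast at g3' ⊢; linear_combination g3')
  clear g1' g2' g3' g1 g2 g3 h₁ h₂ h₃ hx hy
  have hij : i = j ∧ j = k := by
    by_contra hne
    have hd : 2 * j - i - k ≠ 0 := by omega
    have : 2 * j - i - k = 1 ∨ 2 * j - i - k = -1 ∨ 2 * j - i - k = 2 ∨ 2 * j - i - k = -2 := by
      omega
    rcases this with h | h | h | h
    · exact hd (k2 (by rw [h]; decide)).2.1
    · exact hd (k2 (by rw [h]; decide)).2.1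
    · exact hd (k3 (by rw [h]; decide)).2.1
    · exact hd (k3 (by rw [h]; decide)).2.1
  obtain ⟨rfl, rfl⟩ := hij
  have h0 : 2 * i - i - i = 0 := by ring
  rw [h0] at k2 k3
  obtain ⟨-, -, rfl, rfl⟩ := k2 List.mem_cons_self
  obtain ⟨-, -, rfl, rfl⟩ := k3 List.mem_cons_self
  exact ⟨rfl, rfl, rfl, rfl⟩

theorem exists_separatesColored :
    ∃ M : ℕ, 0 < M ∧ ∃ (σ : Equiv.Perm (ZMod M)) (h : ZMod M), SeparatesColored σ h := by
  obtain ⟨f₁, h₁⟩ := exists_separatesNear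
  obtain ⟨f₂, h₂⟩ := exists_perm_avoids_zero_one
  obtain ⟨f₃, h₃⟩ := exists_perm_avoids_zero_two
  exact ⟨20 * 47 * 49 * 51 * 23 * 29, by norm_num, _, _,
    (separatesColored_prodCongr h₁ h₂ h₃).congr
      ((ZMod.chineseRemainder (m := 20 * 47 * 49 * 51 * 23) (n := 29) (by norm_num)).trans
        ((ZMod.chineseRemainder (m := 20 * 47 * 49 * 51) (n := 23) (by norm_num)).prodCongr
          (RingEquiv.refl _)))⟩

/-! ### Rankings of finite sets of integers -/

/-- `g` maps the finite set `D` of integers bijectively onto `{0, …, |D| - 1}`, and sends no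
non-constant triple with second difference at most `s` in absolute value to one with second
difference at most `t`. -/
def IsAvoidingRanking (s t : ℤ) (D : Finset ℤ) (g : ℤ → ℤ) : Prop :=
  (∀ x ∈ D, 0 ≤ g x ∧ g x < D.card) ∧ Set.InjOn g D ∧
    ∀ a ∈ D, ∀ b ∈ D, ∀ c ∈ D, |a + c - 2 * b| ≤ s → |g a + g c - 2 * g b| ≤ t → a = b ∧ b = c

/-- Rank by `κ` first and inside each class by its own ranking. The offset of a class is the number
of elements with smaller `κ`, and it cancels in second differences within the class. -/
theorem exists_glued_ranking {s t : ℤ} (D : Finset ℤ) (κ : ℤ → ℤ)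
    (H : ∀ j, ∃ g, IsAvoidingRanking s t (D.filter (κ · = j)) g) :
    ∃ g : ℤ → ℤ, (∀ x ∈ D, 0 ≤ g x ∧ g x < D.card) ∧ Set.InjOn g D ∧
      (∀ x ∈ D, ∀ y ∈ D, κ x < κ y → g x < g y) ∧
      ∀ a ∈ D, ∀ b ∈ D, ∀ c ∈ D, κ a = κ b → κ b = κ c → |a + c - 2 * b| ≤ s →
        |g a + g c - 2 * g b| ≤ t → a = b ∧ b = c := by
  choose G hG using H
  have hmem : ∀ x ∈ D, x ∈ D.filter (κ · = κ x) := fun x hx => by simp [hx]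
  have hlt : ∀ x ∈ D, ∀ z : ℤ, κ x < z →
      ((D.filter (κ · < κ x)).card : ℤ) + G (κ x) x < (D.filter (κ · < z)).card := by
    intro x hx z hz
    have h1 : (D.filter (κ · < κ x)).card + (D.filter (κ · = κ x)).card ≤
        (D.filter (κ · < z)).card := by
      rw [← Finset.card_union_of_disjoint]
      · apply Finset.card_le_card
        intro y
        simp only [Finset.mem_union, Finset.mem_filter]
        rintro (⟨h, h'⟩ | ⟨h, h'⟩)
        · exact ⟨h, h'.trans hz⟩
        · exact ⟨h, h' ▸ hz⟩
      · rw [Finset.disjoint_filter]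
        intro y _ h h'
        exact absurd h' h.ne
    have h2 := ((hG (κ x)).1 x (hmem x hx)).2
    have h3 : ((D.filter (κ · < κ x)).card : ℤ) + (D.filter (κ · = κ x)).card ≤
        (D.filter (κ · < z)).card := by exact_mod_cast h1
    linarith
  have hmono : ∀ x ∈ D, ∀ y ∈ D, κ x < κ y →
      ((D.filter (κ · < κ x)).card : ℤ) + G (κ x) x <
        (D.filter (κ · < κ y)).card + G (κ y) y := by
    intro x hx y hy hxy
    have h1 := hlt x hx _ hxy
    have h2 := ((hG (κ y)).1 y (hmem y hy)).1
    linarith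
  refine ⟨fun x => (D.filter (κ · < κ x)).card + G (κ x) x, ?_, ?_, hmono, ?_⟩
  · intro x hx
    have h2 := ((hG (κ x)).1 x (hmem x hx)).1
    refine ⟨by positivity, ?_⟩
    have h3 := hlt x hx (κ x + 1) (by omega)
    have h4 : ((D.filter (κ · < κ x + 1)).card : ℤ) ≤ D.card := by
      exact_mod_cast Finset.card_filter_le _ _
    exact h3.trans_le h4
  · intro x hx y hy hxy
    rcases lt_trichotomy (κ x) (κ y) with h | h | h
    · exact absurd hxy (hmono x hx y hy h).ne
    · simp only [h, add_right_inj] at hxy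
      exact (hG (κ y)).2.1 (by simp [h, Finset.mem_coe.1 hx]) (by simp [Finset.mem_coe.1 hy]) hxy
    · exact absurd hxy (hmono y hy x hx h).ne'
  · intro a ha b hb c hc hab hbc h1 h2
    simp only [hab, hbc] at h2
    refine (hG (κ c)).2.2 a (by simp [ha, hab, hbc]) b (by simp [hb, hbc]) c (by simp [hc]) h1 ?_
    convert h2 using 2
    ring

/-- A ranking that respects a division of `D` into `M` cells of at least `q` elements each puts
every element near `q` times the number of its cell. -/
theorem ranking_mem_cell {D : Finset ℤ} {g : ℤ → ℤ} {M q : ℕ} {cell : ℤ → ℕ}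
    (hg : ∀ x ∈ D, 0 ≤ g x ∧ g x < D.card) (hinj : Set.InjOn g D)
    (hmono : ∀ x ∈ D, ∀ y ∈ D, cell x < cell y → g x < g y)
    (hcell : ∀ x ∈ D, cell x < M) (hq : ∀ c < M, q ≤ (D.filter (cell · = c)).card)
    {x : ℤ} (hx : x ∈ D) :
    (cell x * q : ℤ) ≤ g x ∧ g x < cell x * q + q + (D.card - M * q) := by
  have key : ∀ I : Finset ℕ, (∀ c ∈ I, c < M) →
      I.card * q ≤ (D.filter (cell · ∈ I)).card := by
    intro I hI
    have : (D.filter (cell · ∈ I)).card = ∑ c ∈ I, (D.filter (cell · = c)).card := by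
      rw [Finset.card_eq_sum_card_fiberwise (f := cell) (t := I)]
      · refine Finset.sum_congr rfl fun c hc => ?_
        congr 1
        ext y
        simp only [Finset.mem_filter]
        constructor
        · rintro ⟨⟨h1, -⟩, h2⟩; exact ⟨h1, h2⟩
        · rintro ⟨h1, h2⟩; exact ⟨⟨h1, h2 ▸ hc⟩, h2⟩
      · intro y hy
        exact (Finset.mem_filter.1 hy).2
    rw [this, ← smul_eq_mul]
    exact Finset.card_nsmul_le_sum _ _ _ fun c hc => hq c (hI c hc)
  have hcx := hcell x hx
  obtain ⟨h0, hN⟩ := hg x hx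
  constructor
  · have h1 := key (Finset.range (cell x)) fun c hc => (Finset.mem_range.1 hc).trans hcx
    have h2 : (D.filter (cell · ∈ Finset.range (cell x))).card ≤ (Finset.Ico 0 (g x)).card := by
      apply Finset.card_le_card_of_injOn g
      · intro y hy
        simp only [Finset.coe_filter, Finset.mem_range, Set.mem_ofPred_eq] at hy
        simp only [Finset.coe_Ico, Set.mem_Ico]
        exact ⟨(hg y hy.1).1, hmono y hy.1 x hx hy.2⟩
      · exact hinj.mono (Finset.coe_subset.2 (Finset.filter_subset _ _))
    rw [Int.card_Ico, sub_zero] at h2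
    rw [Finset.card_range] at h1
    zify at h1 h2
    rw [Int.toNat_of_nonneg h0] at h2
    exact h1.trans h2
  · have h1 := key (Finset.Ioo (cell x) M) fun c hc => (Finset.mem_Ioo.1 hc).2
    have h2 : (D.filter (cell · ∈ Finset.Ioo (cell x) M)).card ≤
        (Finset.Ioo (g x) D.card).card := by
      apply Finset.card_le_card_of_injOn g
      · intro y hy
        simp only [Finset.coe_filter, Finset.mem_Ioo, Set.mem_ofPred_eq] at hy
        simp only [Finset.coe_Ioo, Set.mem_Ioo]
        exact ⟨hmono x hx y hy.1 hy.2.1, (hg y hy.1).2⟩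
      · exact hinj.mono (Finset.coe_subset.2 (Finset.filter_subset _ _))
    rw [Int.card_Ioo] at h2
    rw [Nat.card_Ioo] at h1
    have h3 := h1.trans h2
    zify at h3
    rw [Int.toNat_of_nonneg (by omega), Nat.sub_sub, Nat.cast_sub (by omega)] at h3
    push_cast at h3
    linarith

/-- The offsets contribute less than `2(q + E)` in absolute value, so the coarse difference times
`q` is below `2q + 2E + |w| ≤ 3q`. This is the source of the bound 2 in `SeparatesNear`. -/
theorem abs_coarse_difference_le {q E ja jb jc ea eb ec w : ℤ}
    (ha : 0 ≤ ea ∧ ea < q + E) (hb : 0 ≤ eb ∧ eb < q + E) (hc : 0 ≤ ec ∧ ec < q + E) {k : ℤ}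
    (h : (ja + jc - 2 * jb - k) * q + (ea + ec - 2 * eb) = w) (hw : |w| + 2 * E ≤ q) :
    |ja + jc - 2 * jb - k| ≤ 2 := by
  obtain ⟨h1, h2⟩ := abs_le.1 (le_refl |w|)
  have hq : 0 < q := by
    by_contra hq
    have := abs_nonneg w
    linarith
  rw [abs_le]
  constructor
  · by_contra hlt
    have : ja + jc - 2 * jb - k ≤ -3 := by omega
    nlinarith
  · by_contra hlt
    have : 3 ≤ ja + jc - 2 * jb - k := by omega
    nlinarith

theorem IsAvoidingRanking.image {s s' t : ℤ} {D : Finset ℤ} {g : ℤ → ℤ}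
    (hg : IsAvoidingRanking s' t D g) (u : ℤ) {B : ℤ} (hB : 0 < B)
    (hs : ∀ z, |B * z| ≤ s → |z| ≤ s') :
    ∃ g, IsAvoidingRanking s t (D.image fun y => u + B * y) g := by
  have hinj : Function.Injective fun y => u + B * y := fun y z h => by
    simpa [hB.ne'] using h
  have hdiv : ∀ y, (u + B * y - u) / B = y := fun y => by
    rw [add_sub_cancel_left, Int.mul_ediv_cancel_left _ hB.ne']
  refine ⟨fun x => g ((x - u) / B), ?_, ?_, ?_⟩
  · simp only [Finset.mem_image, forall_exists_index, and_imp, forall_apply_eq_imp_iff₂, hdiv,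
      Finset.card_image_of_injective D hinj]
    exact hg.1
  · intro x hx y hy hxy
    simp only [Finset.coe_image, Set.mem_image, Finset.mem_coe] at hx hy
    obtain ⟨x, hx, rfl⟩ := hx
    obtain ⟨y, hy, rfl⟩ := hy
    simp only [hdiv] at hxy
    rw [hg.2.1 hx hy hxy]
  · simp only [Finset.mem_image, forall_exists_index, and_imp, forall_apply_eq_imp_iff₂, hdiv]
    intro a ha b hb c hc h1 h2
    have := hg.2.2 a ha b hb c hc (hs _ (by convert h1 using 2; ring)) h2
    rw [this.1, this.2]
    exact ⟨rfl, rfl⟩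

theorem IsAvoidingRanking.inverse {s t : ℤ} {L : ℕ} {g : ℤ → ℤ}
    (hg : IsAvoidingRanking s t (Finset.Ico 0 L) g) :
    ∃ g, IsAvoidingRanking t s (Finset.Ico (0 : ℤ) L) g := by
  have hcard : ((Finset.Ico (0 : ℤ) L).card : ℤ) = L := by simp
  have hmaps : ∀ x ∈ Finset.Ico (0 : ℤ) L, g x ∈ Finset.Ico (0 : ℤ) L := fun x hx => by
    have := hg.1 x hx
    rw [hcard] at this
    exact Finset.mem_Ico.2 this
  have hsurj : ∀ y ∈ Finset.Ico (0 : ℤ) L, ∃ x ∈ Finset.Ico (0 : ℤ) L, g x = y := fun y hy =>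
    Finset.surjOn_of_injOn_of_card_le g hmaps hg.2.1 le_rfl hy
  choose! f hf using hsurj
  refine ⟨f, ?_, ?_, ?_⟩
  · intro y hy
    rw [hcard]
    exact Finset.mem_Ico.1 (hf y hy).1
  · intro x hx y hy hxy
    rw [← (hf x hx).2, ← (hf y hy).2, hxy]
  · intro a ha b hb c hc h1 h2
    have h3 := hg.2.2 _ (hf a ha).1 _ (hf b hb).1 _ (hf c hc).1 h2
      (by rwa [(hf a ha).2, (hf b hb).2, (hf c hc).2])
    constructor
    · rw [← (hf a ha).2, ← (hf b hb).2, h3.1]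
    · rw [← (hf b hb).2, ← (hf c hc).2, h3.2]

theorem isAvoidingRanking_empty (s t : ℤ) (g : ℤ → ℤ) : IsAvoidingRanking s t ∅ g := by
  simp [IsAvoidingRanking]

theorem exists_ranking_Ico_zero_zero (L : ℕ) :
    ∃ g, IsAvoidingRanking 0 0 (Finset.Ico (0 : ℤ) L) g := by
  induction L using Nat.strong_induction_on with
  | _ L ih =>
    by_cases hL : L ≤ 1
    · refine ⟨fun _ => 0, ?_, ?_, ?_⟩
      · intro x hx
        have := Finset.card_pos.2 ⟨x, hx⟩
        exact ⟨le_rfl, Int.natCast_pos.2 this⟩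
      · intro x hx y hy _
        simp only [Finset.coe_Ico, Set.mem_Ico] at hx hy
        omega
      · intro a ha b hb c hc _ _
        simp only [Finset.mem_Ico] at ha hb hc
        omega
    · obtain ⟨g, h1, h2, h3, h4⟩ := exists_glued_ranking (s := 0) (t := 0)
        (Finset.Ico (0 : ℤ) L) (fun x => x % 2) (by
          intro j
          by_cases hj : j = 0 ∨ j = 1
          · obtain ⟨g, hg⟩ := ih ((L + 1 - j.toNat) / 2) (by omega)
            obtain ⟨g', hg'⟩ := hg.image (s := 0) j (B := 2) (by norm_num)
              (fun z hz => by
                have := abs_nonpos_iff.1 hz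
                simp at this
                simp [this])
            refine ⟨g', ?_⟩
            convert hg' using 1
            ext x
            simp only [Finset.mem_filter, Finset.mem_Ico, Finset.mem_image]
            constructor
            · rintro ⟨hx1, hx2⟩
              exact ⟨x / 2, by omega, by omega⟩
            · rintro ⟨y, hy, rfl⟩
              omega
          · refine ⟨fun _ => 0, ?_⟩
            rw [Finset.filter_eq_empty_iff.2]
            · exact isAvoidingRanking_empty _ _ _
            · intro x _
              omega)
      refine ⟨g, h1, h2, ?_⟩
      intro a ha b hb c hc hac hg
      rw [abs_nonpos_iff] at hac hg
      -- The ends of a progression have equal parity. If the middle has the other parity, both ends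
      -- rank on the same side of it.
      have hpar : a % 2 = c % 2 := by omega
      rcases lt_trichotomy (a % 2) (b % 2) with h | h | h
      · have := h3 a ha b hb h
        have := h3 c hc b hb (hpar ▸ h)
        omega
      · exact h4 a ha b hb c hc h (h ▸ hpar) (by rw [hac, abs_zero]) (by rw [hg, abs_zero])
      · have := h3 b hb a ha h
        have := h3 b hb c hc (hpar ▸ h)
        omega

/-! ### Residue classes in an interval -/

/-- The integers in an interval that have their residue modulo `B` in a given set. -/
noncomputable def residueInterval (B u : ℤ) (L : ℕ) (R : Finset ℤ) : Finset ℤ :=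
  (Finset.Ico u (u + L)).filter (· % B ∈ R)

theorem exists_residueInterval_singleton {B : ℤ} (hB : 0 < B) (u : ℤ) (L : ℕ) {r : ℤ}
    (hr : 0 ≤ r ∧ r < B) : ∃ (v : ℤ) (l : ℕ), (L : ℤ) / B ≤ l ∧ (l : ℤ) ≤ L / B + 1 ∧
      residueInterval B u L {r} = (Finset.Ico (0 : ℤ) l).image fun y => v + B * y := by
  -- `u + d` is the least integer from `u` on that is congruent to `r`; the length used below is `(L
  -- - d) / B` rounded up.
  obtain ⟨d, hd⟩ : ∃ d, d = (r - u) % B := ⟨_, rfl⟩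
  have hd0 : 0 ≤ d := hd ▸ Int.emod_nonneg _ hB.ne'
  have hdB : d < B := hd ▸ Int.emod_lt_of_pos _ hB
  have hdr : (u + d) % B = r := by
    rw [hd, Int.add_emod_emod, add_sub_cancel, Int.emod_eq_of_lt hr.1 hr.2]
  have hL : 0 ≤ (L : ℤ) - d + B - 1 := by omega
  have hl : 0 ≤ ((L : ℤ) - d + B - 1) / B := Int.ediv_nonneg hL hB.le
  refine ⟨u + d, (((L : ℤ) - d + B - 1) / B).toNat, ?_, ?_, ?_⟩
  · rw [Int.toNat_of_nonneg hl]
    exact Int.ediv_le_ediv hB (by omega)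
  · have h1 : (L : ℤ) / B + 1 = (L + B) / B := by
      rw [Int.add_ediv_of_dvd_right (dvd_refl B), Int.ediv_self hB.ne']
    rw [Int.toNat_of_nonneg hl, h1]
    exact Int.ediv_le_ediv hB (by omega)
  · ext x
    simp only [residueInterval, Finset.mem_filter, Finset.mem_Ico, Finset.mem_singleton,
      Finset.mem_image, Int.toNat_of_nonneg hl]
    have hy : ∀ y : ℤ, y < ((L : ℤ) - d + B - 1) / B ↔ B * y < L - d := by
      intro y
      rw [← Int.add_one_le_iff, Int.le_ediv_iff_mul_le hB]
      constructor <;> intro h <;> nlinarith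
    constructor
    · rintro ⟨⟨h1, h2⟩, h3⟩
      have h4 : B ∣ x - (u + d) := Int.dvd_of_emod_eq_zero (Int.emod_eq_emod_iff_emod_sub_eq_zero.1
        (h3.trans hdr.symm))
      obtain ⟨y, hxy⟩ := h4
      refine ⟨y, ⟨?_, ?_⟩, by omega⟩
      · by_contra hneg
        have : y ≤ -1 := by omega
        nlinarith
      · rw [hy]; omega
    · rintro ⟨y, ⟨h1, h2⟩, rfl⟩
      rw [hy] at h2
      have := mul_nonneg hB.le h1
      exact ⟨⟨by omega, by omega⟩, by rw [Int.add_mul_emod_self_left, hdr]⟩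

theorem card_residueInterval {B : ℤ} (hB : 0 < B) (u : ℤ) (L : ℕ) {R : Finset ℤ}
    (hR : ∀ r ∈ R, 0 ≤ r ∧ r < B) :
    R.card * ((L : ℤ) / B) ≤ (residueInterval B u L R).card ∧
      ((residueInterval B u L R).card : ℤ) ≤ R.card * ((L : ℤ) / B + 1) := by
  have h1 : ((residueInterval B u L R).card : ℤ) =
      ∑ r ∈ R, ((residueInterval B u L {r}).card : ℤ) := by
    rw [Finset.card_eq_sum_card_fiberwise (f := (· % B)) (t := R)]
    · push_cast
      refine Finset.sum_congr rfl fun r hr => ?_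
      congr 2
      ext x
      simp only [residueInterval, Finset.mem_filter, Finset.mem_singleton]
      constructor
      · rintro ⟨⟨h1, -⟩, h2⟩; exact ⟨h1, h2⟩
      · rintro ⟨h1, h2⟩; exact ⟨⟨h1, h2 ▸ hr⟩, h2⟩
    · intro x hx
      exact (Finset.mem_filter.1 hx).2
  have h2 : ∀ r ∈ R, (L : ℤ) / B ≤ (residueInterval B u L {r}).card ∧
      ((residueInterval B u L {r}).card : ℤ) ≤ L / B + 1 := by
    intro r hr
    obtain ⟨v, l, hl, hl', h⟩ := exists_residueInterval_singleton hB u L (hR r hr)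
    rw [h, Finset.card_image_of_injective _ fun y z h => by simpa [hB.ne'] using h]
    simpa using ⟨hl, hl'⟩
  rw [h1, ← nsmul_eq_mul, ← nsmul_eq_mul]
  exact ⟨Finset.card_nsmul_le_sum _ _ _ fun r hr => (h2 r hr).1,
    Finset.sum_le_card_nsmul _ _ _ fun r hr => (h2 r hr).2⟩

theorem exists_ranking_residueInterval_singleton {s t B : ℤ} (hs : s < B) (hB : 0 < B)
    {L₀ : ℕ} (H : ∀ L : ℕ, L₀ ≤ L → ∃ g, IsAvoidingRanking 0 t (Finset.Ico (0 : ℤ) L) g)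
    {r : ℤ} (hr : 0 ≤ r ∧ r < B) (u : ℤ) (L : ℕ) (hL : B * L₀ ≤ L) :
    ∃ g, IsAvoidingRanking s t (residueInterval B u L {r}) g := by
  obtain ⟨v, l, hl, -, h⟩ := exists_residueInterval_singleton hB u L hr
  have h1 : (L₀ : ℤ) ≤ L / B := by
    rw [Int.le_ediv_iff_mul_le hB]; linarith
  obtain ⟨g, hg⟩ := H l (by omega)
  rw [h]
  refine hg.image v hB fun z hz => ?_
  rw [abs_mul, abs_of_pos hB] at hz
  by_contra hne
  have : 1 ≤ |z| := by omega
  nlinarith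

/-! ### Cutting an interval into pieces -/

/-- The index of `x` in the division of an interval of length `L` starting at `u` into `M`
intervals of length `L / M`, the last one extended to the end. -/
def pieceIndex (u : ℤ) (L M : ℕ) (x : ℤ) : ℕ := min ((x - u) / (L / M : ℕ)).toNat (M - 1)

/-- The length of the `j`-th interval in that division. -/
def pieceLength (L M j : ℕ) : ℕ := if j = M - 1 then L / M + L % M else L / M

theorem pieceIndex_eq_iff {u : ℤ} {L M j : ℕ} (hL : 0 < L / M) (hj : j < M) (x : ℤ) :
    ((u ≤ x ∧ x < u + L) ∧ pieceIndex u L M x = j) ↔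
      u + j * (L / M : ℕ) ≤ x ∧ x < u + j * (L / M : ℕ) + pieceLength L M j := by
  obtain ⟨M, rfl⟩ : ∃ m, M = m + 1 := ⟨M - 1, by omega⟩
  have hdiv := Nat.div_add_mod L (M + 1)
  rw [pieceIndex, pieceLength]
  generalize L / (M + 1) = l at *
  generalize L % (M + 1) = r at *
  have hl : (0 : ℤ) < l := by exact_mod_cast hL
  zify at hdiv
  obtain ⟨d, hd⟩ : ∃ d, d = (x - u) / (l : ℤ) := ⟨_, rfl⟩
  have h1 : d * l ≤ x - u := hd ▸ Int.ediv_mul_le _ hl.ne'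
  have h2 : x - u < (d + 1) * l := hd ▸ Int.lt_ediv_add_one_mul_self _ hl
  rw [← hd, Nat.add_sub_cancel]
  have hMj : (j : ℤ) ≤ M := by omega
  constructor
  · rintro ⟨⟨hx1, hx2⟩, hj'⟩
    have hd0 : 0 ≤ d := hd ▸ Int.ediv_nonneg (by omega) hl.le
    split_ifs with hjM
    · subst hjM
      have : (j : ℤ) ≤ d := by omega
      push_cast
      constructor <;> nlinarith
    · have : d = j := by omega
      subst this
      constructor <;> nlinarith
  · rintro ⟨hx1, hx2⟩
    have hjd : (j : ℤ) ≤ d := by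
      by_contra hlt
      have : d + 1 ≤ j := by omega
      nlinarith
    have hju : 0 ≤ (j : ℤ) * l := by positivity
    split_ifs at hx2 with hjM
    · subst hjM
      push_cast at hx2
      exact ⟨⟨by omega, by nlinarith⟩, by omega⟩
    · have hdj : d = j := by
        by_contra hne
        have : (j : ℤ) + 1 ≤ d := by omega
        nlinarith
      have : (j : ℤ) + 1 ≤ M := by omega
      refine ⟨⟨by omega, ?_⟩, by omega⟩
      have : ((j : ℤ) + 1) * l ≤ M * l := mul_le_mul_of_nonneg_right this hl.le
      have : (0 : ℤ) ≤ r := by positivity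
      nlinarith

theorem pieceIndex_lt {M : ℕ} (hM : 0 < M) (u : ℤ) (L : ℕ) (x : ℤ) : pieceIndex u L M x < M := by
  rw [pieceIndex]; omega

theorem le_pieceLength (L M j : ℕ) : L / M ≤ pieceLength L M j := by
  rw [pieceLength]; split_ifs <;> omega

theorem pieceLength_lt {M : ℕ} (hM : 0 < M) (L j : ℕ) : pieceLength L M j < L / M + M := by
  have := Nat.mod_lt L hM
  rw [pieceLength]; split_ifs <;> omega

theorem abs_pieceIndex_difference_le {u : ℤ} {L M : ℕ} (hM : 0 < M) (hL : 0 < L / M)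
    {a b c : ℤ} (ha : u ≤ a ∧ a < u + L) (hb : u ≤ b ∧ b < u + L) (hc : u ≤ c ∧ c < u + L)
    {k w : ℤ} (hw : a + c - 2 * b = k * (L / M : ℕ) + w) (h : |w| + 2 * M ≤ (L / M : ℕ)) :
    |(pieceIndex u L M a : ℤ) + pieceIndex u L M c - 2 * pieceIndex u L M b - k| ≤ 2 := by
  have key : ∀ x : ℤ, u ≤ x ∧ x < u + L → 0 ≤ x - u - pieceIndex u L M x * (L / M : ℕ) ∧
      x - u - pieceIndex u L M x * (L / M : ℕ) < (L / M : ℕ) + M := by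
    intro x hx
    have h1 := (pieceIndex_eq_iff hL (pieceIndex_lt hM u L x) x).1 ⟨hx, rfl⟩
    have h2 := pieceLength_lt hM L (pieceIndex u L M x)
    omega
  exact abs_coarse_difference_le (key a ha) (key b hb) (key c hc) (w := w)
    (by linear_combination hw) h

theorem mem_residueInterval {B u x : ℤ} {L : ℕ} {R : Finset ℤ} :
    x ∈ residueInterval B u L R ↔ (u ≤ x ∧ x < u + L) ∧ x % B ∈ R := by
  rw [residueInterval, Finset.mem_filter, Finset.mem_Ico]

theorem card_residueInterval_le_of_div {B : ℤ} (hB : 0 < B) {M : ℕ} (hM : 0 < M) (u : ℤ)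
    {L l w : ℕ} (hl : l = L / M) (hw : (l : ℤ) / B = w) {R : Finset ℤ}
    (hR : ∀ r ∈ R, 0 ≤ r ∧ r < B) :
    ((residueInterval B u L R).card : ℤ) ≤ M * (R.card * w : ℕ) + R.card * M := by
  have h1 := (card_residueInterval hB u L hR).2
  have h2 : (L : ℤ) / B + 1 ≤ M * (w + 1) := by
    have h3 : (L : ℤ) < M * (l + 1) := by
      have := Nat.lt_mul_div_succ L hM
      rw [← hl] at this
      exact_mod_cast this
    have h4 : (l : ℤ) + 1 ≤ B * (w + 1) := by
      rw [← hw]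
      have := Int.lt_ediv_add_one_mul_self (l : ℤ) hB
      linarith
    have h5 : (M : ℤ) * (l + 1) ≤ M * (B * (w + 1)) := mul_le_mul_of_nonneg_left h4 (by positivity)
    have := Int.ediv_lt_of_lt_mul hB (show (L : ℤ) < M * (w + 1) * B by linarith)
    omega
  have h3 : (R.card : ℤ) * ((L : ℤ) / B + 1) ≤ R.card * (M * (w + 1)) :=
    mul_le_mul_of_nonneg_left h2 (by positivity)
  push_cast
  linarith

/-! ### Merging residue classes -/

-- Induction on `R`. Elements of the new class `r` get color 1, the others color 0, and the block of
-- piece `p` and color `e` goes to cell `σ p + h e`. Each cell thus receives one block of either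
-- color, so the cells have nearly equal size although the blocks do not. `SeparatesColored` then
-- puts a bad triple into a single block.
set_option maxHeartbeats 800000 in
theorem exists_ranking_residueInterval {s t B : ℤ} (hs : s < B) (hB : 0 < B)
    {L₀ : ℕ} (H : ∀ L : ℕ, L₀ ≤ L → ∃ g, IsAvoidingRanking 0 t (Finset.Ico (0 : ℤ) L) g)
    {R : Finset ℤ} (hne : R.Nonempty) (hR : ∀ r ∈ R, 0 ≤ r ∧ r < B) :
    ∃ L₁ : ℕ, ∀ (L : ℕ) (u : ℤ), L₁ ≤ L →
      ∃ g, IsAvoidingRanking s t (residueInterval B u L R) g := by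
  induction hne using Finset.Nonempty.cons_induction with
  | singleton r =>
    refine ⟨B.toNat * L₀, fun L u hL => ?_⟩
    refine exists_ranking_residueInterval_singleton hs hB H (hR r (by simp)) u L ?_
    zify at hL
    rwa [Int.toNat_of_nonneg hB.le] at hL
  | cons r R hr hne ih =>
    have hR' : ∀ x ∈ R, 0 ≤ x ∧ x < B := fun x hx => hR x (by simp [hx])
    have hrB := hR r (by simp)
    obtain ⟨L₁, hL₁⟩ := ih hR'
    obtain ⟨M, hM, σ, h, hσ⟩ := exists_separatesColored
    have : NeZero M := ⟨hM.ne'⟩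
    -- The summands make a piece long enough for the induction hypothesis, for the single class `r`,
    -- for rounding at the source, and, through `w ≥ t + 2M + 1`, for rounding at the target.
    refine ⟨M * (L₁ + B.toNat * L₀ + s.toNat + 2 * M + 1 + B.toNat * (t.toNat + 2 * M + 1)),
      fun L u hL => ?_⟩
    have hl := (Nat.le_div_iff_mul_le hM).2 ((mul_comm _ _).trans_le hL)
    obtain ⟨l, hl_def⟩ : ∃ l, l = L / M := ⟨_, rfl⟩
    rw [← hl_def] at hl
    have hl0 : 0 < L / M := by rw [← hl_def]; omega
    obtain ⟨w, hw⟩ := Int.eq_ofNat_of_zero_le (Int.ediv_nonneg (Int.natCast_nonneg l) hB.le)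
    have hlz : L₁ + B * L₀ + s.toNat + 2 * M + 1 + B * (t.toNat + 2 * M + 1) ≤ (l : ℤ) := by
      have := hl
      zify at this
      rwa [Int.toNat_of_nonneg hB.le] at this
    have hBL₀ : 0 ≤ B * L₀ := by positivity
    have hBt : 0 ≤ B * (t.toNat + 2 * M + 1) := by positivity
    have htw : t + 2 * M + 1 ≤ w := by
      rw [← hw, Int.le_ediv_iff_mul_le hB]
      have : (t + 2 * M + 1) * B ≤ (t.toNat + 2 * M + 1) * B :=
        mul_le_mul_of_nonneg_right (by omega) hB.le
      linarith
    set D := residueInterval B u L (Finset.cons r R hr) with hD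
    let p : ℤ → ℕ := pieceIndex u L M
    let e : ℤ → ℤ := fun x => if x % B = r then 1 else 0
    let cell : ℤ → ℕ := fun x => (σ (p x : ZMod M) + h * e x).val
    have he : ∀ x, e x = 0 ∨ e x = 1 := fun x => by
      simp only [e]; split_ifs <;> simp
    have hp : ∀ x, p x < M := fun x => pieceIndex_lt hM u L x
    have hcast : ∀ x y, (p x : ZMod M) = p y → p x = p y := fun x y hxy => by
      have := (ZMod.natCast_eq_natCast_iff' _ _ _).1 hxy
      rwa [Nat.mod_eq_of_lt (hp x), Nat.mod_eq_of_lt (hp y)] at this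
    have hcell : ∀ x, (cell x : ZMod M) = σ (p x : ZMod M) + h * e x := fun x =>
      ZMod.natCast_zmod_val _
    -- As `e` is 0 or 1, this key orders by cell and then by color, and its fibers are single
    -- blocks.
    obtain ⟨g, g1, g2, g3, g4⟩ := exists_glued_ranking (s := s) (t := t) D
      (fun x => 2 * cell x + e x) (by
        intro j
        rcases (D.filter (fun x => 2 * (cell x : ℤ) + e x = j)).eq_empty_or_nonempty with hE | hE
        · rw [hE]; exact ⟨fun _ => 0, isAvoidingRanking_empty _ _ _⟩
        obtain ⟨x₀, hx₀⟩ := hE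
        obtain ⟨-, hx₀⟩ := Finset.mem_filter.1 hx₀
        have hfib : D.filter (fun x => 2 * (cell x : ℤ) + e x = j) =
            residueInterval B (u + p x₀ * (L / M : ℕ)) (pieceLength L M (p x₀))
              (if e x₀ = 1 then {r} else R) := by
          ext x
          rw [Finset.mem_filter, hD, mem_residueInterval, mem_residueInterval,
            ← pieceIndex_eq_iff hl0 (hp x₀), Finset.mem_cons]
          have hpe : 2 * (cell x : ℤ) + e x = j ↔ p x = p x₀ ∧ e x = e x₀ := by
            rw [← hx₀]
            constructor
            · intro hxx
              have he' : e x = e x₀ := by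
                rcases he x with h1 | h1 <;> rcases he x₀ with h2 | h2 <;> omega
              have hc' : cell x = cell x₀ := by omega
              refine ⟨hcast _ _ (σ.injective ?_), he'⟩
              have := hcell x
              rw [hc', hcell x₀, he'] at this
              exact (add_right_cancel this).symm
            · rintro ⟨h1, h2⟩
              simp only [cell, h1, h2]
          rw [hpe]
          have hex : (x % B = r ∨ x % B ∈ R) ∧ e x = e x₀ ↔
              x % B ∈ (if e x₀ = 1 then {r} else R) := by
            rcases he x₀ with h1 | h1
            · rw [h1, if_neg (by norm_num)]
              simp only [e]
              split_ifs with h2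
              · simp [h2, hr]
              · simp [h2]
            · rw [h1, if_pos rfl]
              simp only [e]
              split_ifs with h2
              · simp [h2]
              · simp [h2]
          rw [← hex]
          simp only [p]
          tauto
        rw [hfib]
        have hlen := le_pieceLength L M (p x₀)
        split_ifs with h1
        · refine exists_ranking_residueInterval_singleton hs hB H hrB _ _ ?_
          zify at hlen
          have : (l : ℤ) = (L : ℤ) / M := by rw [hl_def]; push_cast; rfl
          omega
        · exact hL₁ _ _ (by omega))
    refine ⟨g, g1, g2, fun a ha b hb c hc hac hgac => ?_⟩
    have hDx : ∀ x ∈ D, u ≤ x ∧ x < u + L := fun x hx => (mem_residueInterval.1 hx).1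
    have hsrc : |(p a : ℤ) + p c - 2 * p b - 0| ≤ 2 :=
      abs_pieceIndex_difference_le hM hl0 (hDx a ha) (hDx b hb) (hDx c hc)
        (w := a + c - 2 * b) (by ring) (by rw [← hl_def]; omega)
    rw [sub_zero] at hsrc
    -- Cell `k` contains color 0 of piece `σ⁻¹ k` and color 1 of piece `σ⁻¹ (k - h)`.
    have hq : ∀ k < M, (R.card + 1) * w ≤ (D.filter (cell · = k)).card := by
      intro k hk
      have hsub : ∀ (R' : Finset ℤ) (ε : ℤ), (∀ x ∈ R', x ∈ Finset.cons r R hr) →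
          (∀ x, x % B ∈ R' → e x = ε) → residueInterval B
            (u + (σ.symm (k - h * ε)).val * (L / M : ℕ)) l R' ⊆ D.filter (cell · = k) := by
        intro R' ε h1 h2 x hx
        rw [mem_residueInterval] at hx
        have hlen := le_pieceLength L M (σ.symm (k - h * ε)).val
        obtain ⟨h3, h4⟩ := (pieceIndex_eq_iff hl0 (ZMod.val_lt (σ.symm (k - h * ε))) x).2
          ⟨hx.1.1, by omega⟩
        rw [Finset.mem_filter, hD, mem_residueInterval]
        refine ⟨⟨h3, h1 _ hx.2⟩, ?_⟩
        simp only [cell, p, h4, h2 x hx.2, ZMod.natCast_zmod_val, Equiv.apply_symm_apply,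
          sub_add_cancel]
        rw [ZMod.val_natCast, Nat.mod_eq_of_lt hk]
      have h0 := hsub R 0 (fun x hx => by simp [hx]) (fun x hx => by
        simp only [e]; rw [if_neg]; rintro rfl; exact hr hx)
      have h1 := hsub {r} 1 (fun x hx => by
        rw [Finset.mem_singleton] at hx; simp [hx]) (fun x hx => by
        rw [Finset.mem_singleton] at hx; simp only [e]; rw [if_pos hx])
      have hcard := Finset.card_le_card (Finset.union_subset h0 h1)
      rw [Finset.card_union_of_disjoint] at hcard
      · have c0 := (card_residueInterval hB (u + (σ.symm (k - h * (0 : ℤ))).val * (L / M : ℕ)) l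
          hR').1
        have c1 := (card_residueInterval hB (u + (σ.symm (k - h * (1 : ℤ))).val * (L / M : ℕ)) l
          (R := {r}) (fun x hx => hR x (by
            rw [Finset.mem_singleton] at hx; simp [hx]))).1
        rw [hw, ← Nat.cast_mul, Int.ofNat_le] at c0 c1
        rw [Finset.card_singleton] at c1
        rw [add_mul]
        exact (add_le_add c0 c1).trans hcard
      · rw [Finset.disjoint_left]
        intro x hx hx'
        rw [mem_residueInterval] at hx hx'
        exact hr (Finset.mem_singleton.1 hx'.2 ▸ hx.2)
    have htot := card_residueInterval_le_of_div hB hM u hl_def hw hR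
    rw [← hD, Finset.card_cons] at htot
    have hloc := fun x hx => ranking_mem_cell (x := x) (M := M) (cell := cell)
      (q := (R.card + 1) * w) g1 g2 (fun x hx y hy hxy => g3 x hx y hy (by
        rcases he x with h1 | h1 <;> rcases he y with h2 | h2 <;> omega))
      (fun x _ => ZMod.val_lt _) hq hx
    have hoff : ∀ x ∈ D, 0 ≤ g x - cell x * ((R.card + 1) * w : ℕ) ∧
        g x - cell x * ((R.card + 1) * w : ℕ) < ((R.card + 1) * w : ℕ) + (R.card + 1) * M := by
      intro x hx
      have := hloc x hx
      push_cast at this htot ⊢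
      constructor <;> linarith
    have hbound : |g a + g c - 2 * g b| + 2 * ((R.card + 1) * M : ℤ) ≤ ((R.card + 1) * w : ℕ) := by
      have ht0 : 0 ≤ t := (abs_nonneg _).trans hgac
      have h1 : ((R.card : ℤ) + 1) * (t + 2 * M + 1) ≤ (R.card + 1) * w :=
        mul_le_mul_of_nonneg_left htw (by positivity)
      have h2 : 0 ≤ (R.card : ℤ) * t := by positivity
      push_cast
      linarith
    have htgt : |(cell a : ℤ) + cell c - 2 * cell b - 0| ≤ 2 :=
      abs_coarse_difference_le (hoff a ha) (hoff b hb) (hoff c hc) (w := g a + g c - 2 * g b)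
        (by ring) hbound
    rw [sub_zero] at htgt
    obtain ⟨h1, h2, h3, h4⟩ := hσ (p a) (p b) (p c) (e a) (e b) (e c) _ _ (he a) (he b) (he c)
      hsrc htgt (by push_cast; ring) (by push_cast; rw [hcell, hcell, hcell])
    have hab : cell a = cell b := by simp only [cell, h1, h3]
    have hbc : cell b = cell c := by simp only [cell, h2, h4]
    exact g4 a ha b hb c hc (by simp only [hab, h3]) (by simp only [hbc, h4]) hac hgac

theorem exists_ranking_Ico_of_zero {s t : ℕ} {L₀ : ℕ}
    (H : ∀ L : ℕ, L₀ ≤ L → ∃ g, IsAvoidingRanking 0 t (Finset.Ico (0 : ℤ) L) g) :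
    ∃ L₁ : ℕ, ∀ L : ℕ, L₁ ≤ L → ∃ g, IsAvoidingRanking s t (Finset.Ico (0 : ℤ) L) g := by
  obtain ⟨L₁, hL₁⟩ := exists_ranking_residueInterval (s := s) (B := s + 1) (lt_add_one _)
    (by positivity) H (R := Finset.Ico 0 (s + 1 : ℤ)) ⟨0, by simp⟩
    (fun r hr => Finset.mem_Ico.1 hr)
  refine ⟨L₁, fun L hL => ?_⟩
  obtain ⟨g, hg⟩ := hL₁ L 0 hL
  refine ⟨g, ?_⟩
  convert hg using 1
  ext x
  rw [mem_residueInterval, Finset.mem_Ico, Finset.mem_Ico, zero_add]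
  have h1 := Int.emod_nonneg x (b := (s + 1 : ℤ)) (by positivity)
  have h2 := Int.emod_lt_of_pos x (b := (s + 1 : ℤ)) (by positivity)
  tauto

/-- The parameters pass through `(0, 0)`, `(t, 0)`, `(0, t)` and `(s, t)`, the middle step being
inversion. -/
theorem exists_ranking_Ico (s t : ℕ) :
    ∃ L₁ : ℕ, ∀ L : ℕ, L₁ ≤ L → ∃ g, IsAvoidingRanking s t (Finset.Ico (0 : ℤ) L) g := by
  obtain ⟨L₀, h₀⟩ := exists_ranking_Ico_of_zero (s := t) (t := 0) (L₀ := 0)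
    fun L _ => exists_ranking_Ico_zero_zero L
  refine exists_ranking_Ico_of_zero (L₀ := L₀) fun L hL => ?_
  obtain ⟨g, hg⟩ := h₀ L hL
  exact hg.inverse

/-! ### From intervals to the integers modulo `n` -/

theorem abs_quotient_le_two {n a b c k w : ℤ} (ha : 0 ≤ a ∧ a < n) (hb : 0 ≤ b ∧ b < n)
    (hc : 0 ≤ c ∧ c < n) (h : a + c - 2 * b = n * k + w) (hw : |w| < n) : |k| ≤ 2 := by
  rw [abs_lt] at hw
  have hn : 0 ≤ n := by omega
  rw [abs_le]
  constructor
  · by_contra hk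
    have := mul_le_mul_of_nonneg_left (show k ≤ -3 by omega) hn
    linarith
  · by_contra hk
    have := mul_le_mul_of_nonneg_left (show 3 ≤ k by omega) hn
    linarith

/-- Three numbers in a common window of length `l + E` give `|n k| < 2(l + E) + v ≤ 3l ≤ n`, so
there is no wraparound. -/
theorem quotient_eq_zero {n l E v k w ea eb ec z : ℤ} (ha : 0 ≤ ea - z ∧ ea - z < l + E)
    (hb : 0 ≤ eb - z ∧ eb - z < l + E) (hc : 0 ≤ ec - z ∧ ec - z < l + E)
    (h : ea + ec - 2 * eb = n * k + w) (hw : |w| ≤ v) (hl : 3 * l ≤ n) (hv : v + 2 * E ≤ l) :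
    k = 0 := by
  have hw' := abs_le.1 hw
  have hn : 0 ≤ n := by linarith [abs_nonneg w]
  by_contra hk
  rcases lt_or_gt_of_ne hk with hk | hk
  · have := mul_le_mul_of_nonneg_left (show k ≤ -1 by omega) hn
    linarith
  · have := mul_le_mul_of_nonneg_left (show 1 ≤ k by omega) hn
    linarith

theorem exists_perm_destroysAlmostAPs {M : ℕ} (hM : 3 ≤ M) {σ : Equiv.Perm (ZMod M)}
    (hσ : SeparatesNear σ) {s t L₀ n : ℕ}
    (H : ∀ L : ℕ, L₀ ≤ L → ∃ g, IsAvoidingRanking s t (Finset.Ico (0 : ℤ) L) g)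
    (h₀ : L₀ ≤ n / M) (hs : s + 4 * M < n / M) (ht : t + 4 * M < n / M) :
    ∃ π : Equiv.Perm (ZMod n), DestroysAlmostAPs s t π := by
  have hM0 : 0 < M := by omega
  have : NeZero M := ⟨hM0.ne'⟩
  have hl0 : 0 < n / M := by omega
  have hn : 0 < n := Nat.pos_of_ne_zero fun h => by simp [h] at hl0
  have : NeZero n := ⟨hn.ne'⟩
  obtain ⟨l, hl⟩ : ∃ l, l = n / M := ⟨_, rfl⟩
  obtain ⟨r, hr⟩ : ∃ r, r = n % M := ⟨_, rfl⟩
  have hdiv : (M : ℤ) * l + r = n := by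
    rw [hl, hr]; exact_mod_cast Nat.div_add_mod n M
  have hrM : r < M := hr ▸ Nat.mod_lt n hM0
  set D := Finset.Ico (0 : ℤ) n with hD
  have hDcard : (D.card : ℤ) = n := by simp [hD]
  let p : ℤ → ℕ := pieceIndex 0 n M
  let cell : ℤ → ℕ := fun x => (σ (p x : ZMod M)).val
  have hp : ∀ x, p x < M := fun x => pieceIndex_lt hM0 0 n x
  have hcast : ∀ x y, (p x : ZMod M) = p y → p x = p y := fun x y hxy => by
    have := (ZMod.natCast_eq_natCast_iff' _ _ _).1 hxy
    rwa [Nat.mod_eq_of_lt (hp x), Nat.mod_eq_of_lt (hp y)] at this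
  have hcell : ∀ x, (cell x : ZMod M) = σ (p x : ZMod M) := fun x => ZMod.natCast_zmod_val _
  have hpiece : ∀ j < M, D.filter (p · = j) =
      Finset.Ico (j * (n / M : ℕ) : ℤ) (j * (n / M : ℕ) + pieceLength n M j) := by
    intro j hj
    ext x
    have := pieceIndex_eq_iff (u := 0) hl0 hj x
    rw [zero_add, zero_add] at this
    rw [Finset.mem_filter, hD, Finset.mem_Ico, Finset.mem_Ico, this]
  have hfib : ∀ x₀, D.filter (cell · = cell x₀) = D.filter (p · = p x₀) := by
    intro x₀
    refine Finset.filter_congr fun x _ => ⟨fun h => hcast _ _ (σ.injective ?_), fun h => ?_⟩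
    · rw [← hcell, ← hcell, h]
    · simp only [cell, h]
  obtain ⟨g, g1, g2, g3, g4⟩ := exists_glued_ranking (s := s) (t := t) D (fun x => cell x) (by
    intro j
    rcases (D.filter (fun x => (cell x : ℤ) = j)).eq_empty_or_nonempty with hE | ⟨x₀, hx₀⟩
    · rw [hE]; exact ⟨fun _ => 0, isAvoidingRanking_empty _ _ _⟩
    obtain ⟨-, rfl⟩ := Finset.mem_filter.1 hx₀
    simp only [Nat.cast_inj]
    rw [hfib, hpiece _ (hp x₀)]
    have hlen := le_pieceLength n M (p x₀)
    obtain ⟨g, hg⟩ := H (pieceLength n M (p x₀)) (by omega)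
    obtain ⟨g', hg'⟩ := hg.image (s := s) (p x₀ * (n / M : ℕ)) one_pos
      (fun z hz => by rwa [one_mul] at hz)
    refine ⟨g', ?_⟩
    convert hg' using 1
    simp only [one_mul, Finset.image_add_left_Ico, add_zero])
  have hq : ∀ k < M, n / M ≤ (D.filter (cell · = k)).card := by
    intro k hk
    have h1 := hpiece (σ.symm k).val (ZMod.val_lt _)
    have h2 : D.filter (p · = (σ.symm k).val) ⊆ D.filter (cell · = k) := by
      intro x hx
      rw [Finset.mem_filter] at hx ⊢
      refine ⟨hx.1, ?_⟩
      simp only [cell, hx.2, ZMod.natCast_zmod_val, Equiv.apply_symm_apply]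
      rw [ZMod.val_natCast, Nat.mod_eq_of_lt hk]
    refine le_trans ?_ (Finset.card_le_card h2)
    rw [h1, Int.card_Ico, add_sub_cancel_left, Int.toNat_natCast]
    exact le_pieceLength _ _ _
  have hoff : ∀ x ∈ D, 0 ≤ g x - cell x * (n / M : ℕ) ∧
      g x - cell x * (n / M : ℕ) < (n / M : ℕ) + r := by
    intro x hx
    have h := ranking_mem_cell g1 g2 (fun x hx y hy hxy => g3 x hx y hy (by exact_mod_cast hxy))
      (fun x _ => ZMod.val_lt _) hq hx
    rw [hDcard, ← hl] at h
    rw [← hl]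
    constructor <;> linarith
  have hgn : ∀ x ∈ D, 0 ≤ g x ∧ g x < n := fun x hx => hDcard ▸ g1 x hx
  have hln : 3 * (l : ℤ) ≤ n := by
    have : (3 : ℤ) * l ≤ M * l := mul_le_mul_of_nonneg_right (by exact_mod_cast hM) (by positivity)
    linarith [Int.natCast_nonneg r]
  -- Since `n = M l + r`, wrapping `k` times modulo `n` is wrapping `k` times modulo `M` on piece
  -- indices, with an error `k r` of size at most `2M`.
  have hround : ∀ (k w : ℤ) (v : ℕ), |k| ≤ 2 → |w| ≤ v → v + 4 * M < n / M →
      |k * r + w| + 2 * M ≤ (n / M : ℕ) := by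
    intro k w v hk hw hv
    have h1 : |k * r + w| ≤ 2 * M + v := by
      refine (abs_add_le _ _).trans (add_le_add ?_ hw)
      rw [abs_mul, abs_of_nonneg (Int.natCast_nonneg r)]
      exact mul_le_mul hk (by omega) (by positivity) (by norm_num)
    omega
  have hval : ∀ z : ZMod n, (z.val : ℤ) ∈ D := fun z => by
    rw [hD, Finset.mem_Ico]
    exact ⟨by positivity, by exact_mod_cast z.val_lt⟩
  have hvaln : ∀ z : ZMod n, (0 : ℤ) ≤ z.val ∧ (z.val : ℤ) < n := fun z =>
    Finset.mem_Ico.1 (hval z)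
  have hinj : Function.Injective fun z : ZMod n => ((g z.val : ℤ) : ZMod n) := by
    intro y z hyz
    have h1 := (ZMod.intCast_eq_intCast_iff' _ _ _).1 hyz
    obtain ⟨h2, h3⟩ := hgn _ (hval y)
    obtain ⟨h4, h5⟩ := hgn _ (hval z)
    rw [Int.emod_eq_of_lt h2 h3, Int.emod_eq_of_lt h4 h5] at h1
    have := g2 (hval y) (hval z) h1
    exact ZMod.val_injective n (by exact_mod_cast this)
  have hlift : ∀ (a b c : ℤ) (w : ℤ), (a + c - 2 * b : ZMod n) = w →
      ∃ k : ℤ, a + c - 2 * b = n * k + w := by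
    intro a b c w h
    have h1 : ((a + c - 2 * b - w : ℤ) : ZMod n) = 0 := by
      push_cast; rw [h, sub_self]
    obtain ⟨k, hk⟩ := (ZMod.intCast_zmod_eq_zero_iff_dvd _ _).1 h1
    exact ⟨k, by linarith⟩
  have hzval : ∀ z : ZMod n, (((z.val : ℕ) : ℤ) : ZMod n) = z := fun z => by
    rw [Int.cast_natCast, ZMod.natCast_zmod_val]
  refine ⟨Equiv.ofBijective _ (Finite.injective_iff_bijective.1 hinj), ?_⟩
  rintro ⟨a, b, c, hne, ⟨w₁, hw₁, h1⟩, ⟨w₂, hw₂, h2⟩⟩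
  simp only [Equiv.ofBijective_apply] at h2
  rw [← hzval a, ← hzval b, ← hzval c] at h1
  obtain ⟨k₁, hk₁⟩ := hlift _ _ _ _ h1
  obtain ⟨k₂, hk₂⟩ := hlift _ _ _ _ h2
  have hk₁2 := abs_quotient_le_two (hvaln a) (hvaln b) (hvaln c) hk₁ (by omega)
  have hk₂2 := abs_quotient_le_two (hgn _ (hval a)) (hgn _ (hval b)) (hgn _ (hval c)) hk₂ (by omega)
  have hD' : ∀ z : ZMod n, (0 : ℤ) ≤ z.val ∧ (z.val : ℤ) < 0 + n := fun z => by
    rw [zero_add]; exact hvaln z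
  have hsrc := abs_pieceIndex_difference_le hM0 hl0 (hD' a) (hD' b) (hD' c)
    (k := M * k₁) (w := k₁ * r + w₁) (by rw [hk₁, ← hdiv, ← hl]; ring)
    (hround k₁ w₁ s hk₁2 hw₁ hs)
  have htgt := abs_coarse_difference_le (ja := cell a.val) (jb := cell b.val) (jc := cell c.val)
    (hoff _ (hval a)) (hoff _ (hval b)) (hoff _ (hval c))
    (k := M * k₂) (w := k₂ * r + w₂) (by rw [← hl]; linear_combination hk₂ - k₂ * hdiv)
    (by have := hround k₂ w₂ t hk₂2 hw₂ ht; omega)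
  obtain ⟨-, -, hab, hbc⟩ := hσ (p a.val) (p b.val) (p c.val) _ _ hsrc htgt
    (by push_cast; simp [p]) (by push_cast; rw [hcell, hcell, hcell]; simp)
  have hpab := hcast _ _ hab
  have hpbc := hcast _ _ hbc
  have hpoff : ∀ z : ZMod n, 0 ≤ (z.val : ℤ) - p z.val * (n / M : ℕ) ∧
      (z.val : ℤ) - p z.val * (n / M : ℕ) < (n / M : ℕ) + M := by
    intro z
    have h1 := (pieceIndex_eq_iff hl0 (hp z.val) (z.val : ℤ)).1 ⟨hD' z, rfl⟩
    have h2 := pieceLength_lt hM0 n (p z.val)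
    omega
  have hk₁0 : k₁ = 0 := quotient_eq_zero (hpab ▸ hpoff a) (hpoff b) (hpbc.symm ▸ hpoff c) hk₁ hw₁
    (by rw [← hl]; exact hln) (by omega)
  rw [hk₁0, mul_zero, zero_add] at hk₁
  have hcellab : cell a.val = cell b.val := by simp only [cell, hpab]
  have hcellbc : cell b.val = cell c.val := by simp only [cell, hpbc]
  have hk₂0 : k₂ = 0 := quotient_eq_zero (hcellab ▸ hoff _ (hval a)) (hoff _ (hval b))
    (hcellbc.symm ▸ hoff _ (hval c)) hk₂ hw₂ (by rw [← hl]; exact hln) (by omega)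
  rw [hk₂0, mul_zero, zero_add] at hk₂
  obtain ⟨h3, h4⟩ := g4 _ (hval a) _ (hval b) _ (hval c) (by rw [hcellab]) (by rw [hcellbc])
    (by rw [hk₁]; exact hw₁) (by rw [hk₂]; exact hw₂)
  exact hne ⟨ZMod.val_injective n (by exact_mod_cast h3), ZMod.val_injective n (by exact_mod_cast h4)⟩

theorem DestroysAlmostAPs.destroysAPs {n : ℕ} {π : Equiv.Perm (ZMod n)}
    (h : DestroysAlmostAPs 0 0 π) : DestroysAPs π := by
  rintro ⟨a, b, c, hne, h1, h2⟩
  exact h ⟨a, b, c, hne, ⟨0, by simp, by rw [Int.cast_zero]; linear_combination h1⟩,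
    ⟨0, by simp, by rw [Int.cast_zero]; linear_combination h2⟩⟩

theorem theorem1p2 :
    (∀ n : ℕ, (9 * 11 * 16 * 17 * 19 * 23) ^ 2 ≤ n →
      ∃ π : Equiv.Perm (ZMod n), DestroysAPs π) ∧
    (∀ s t : ℕ, ∃ n₀ : ℕ, ∀ n : ℕ, n₀ ≤ n →
      ∃ π : Equiv.Perm (ZMod n), DestroysAlmostAPs s t π) := by
  obtain ⟨σ, hσ⟩ := exists_separatesNear
  constructor
  · intro n hn
    -- `10000000` exceeds `4M = 9396240` for `M = 20 * 47 * 49 * 51`.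
    have hl : 10000000 ≤ n / (20 * 47 * 49 * 51) := by
      rw [Nat.le_div_iff_mul_le (by norm_num)]
      exact le_trans (by norm_num) hn
    obtain ⟨π, hπ⟩ := exists_perm_destroysAlmostAPs (s := 0) (t := 0) (L₀ := 0) (n := n)
      (by norm_num) hσ (fun L _ => exists_ranking_Ico_zero_zero L) (Nat.zero_le _)
      (lt_of_lt_of_le (by norm_num) hl) (lt_of_lt_of_le (by norm_num) hl)
    exact ⟨π, hπ.destroysAPs⟩
  · intro s t
    obtain ⟨L₀, hL₀⟩ := exists_ranking_Ico s t
    refine ⟨(L₀ + s + t + 10000000) * (20 * 47 * 49 * 51), fun n hn => ?_⟩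
    have hl := (Nat.le_div_iff_mul_le (by norm_num)).2 hn
    exact exists_perm_destroysAlmostAPs (by norm_num) hσ hL₀ (by omega) (by omega) (by omega)
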